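/- All semirings $(S,+,\cdot,0,1)$ have a commutative additive monoid with neutral element $0$, an associative (not necessarily commutative) multiplication with identity $1$ that distributes over addition on both sides, and satisfy $0s=s0=0$; semimodules are unital, and the zero of $S$ annihilates them. A semiring $S$ is called right (left) subtractive if every right (left) ideal $K$ of $S$, i.e. every subsemimodule of the regular right (left) $S$-semimodule, satisfies: $m\in K$ and $m+m'\in K$ imply $m'\in K$. It is called a right (left) CP-semiring if every cyclic right (left) $S$-semimodule, i.e. every homomorphic image of the regular right (left) $S$-semimodule, is projective, i.e. a retract of a free right (left) $S$-semimodule. A Boolean algebra is regarded as a semiring with join as addition, meet as multiplication, the least element as $0$ and the greatest element as $1$. **Theorem.** Let $S$ be a right (respectively left) subtractive semiring. Then $S$ is a right (respectively left) CP-semiring if and only if $S\cong R\oplus T$ as semirings (with componentwise operations), where $R$ is a (classical) semisimple ring and $T$ is a finite Boolean algebra; either summand may be zero. -/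

import Mathlib

universe u v

/-- A subsemimodule `K` of `M` is subtractive if `m ∈ K` and `m + m' ∈ K` imply `m' ∈ K`. -/
def Submodule.IsSubtractive {R : Type u} {M : Type v} [Semiring R] [AddCommMonoid M] [Module R M]
    (K : Submodule R M) : Prop :=
  ∀ m m' : M, m ∈ K → m + m' ∈ K → m' ∈ K

/-- A semimodule is subtractive if all of its subsemimodules are subtractive. -/
def IsSubtractiveSemimodule (R : Type u) (M : Type v) [Semiring R] [AddCommMonoid M]
    [Module R M] : Prop :=
  ∀ K : Submodule R M, K.IsSubtractive

/-- `S` is right subtractive if the regular right semimodule is subtractive. Right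
`S`-semimodules are modules over the opposite semiring. -/
def IsRightSubtractive (S : Type u) [Semiring S] : Prop :=
  IsSubtractiveSemimodule Sᵐᵒᵖ S

/-- `S` is left subtractive if the regular left semimodule is subtractive. -/
def IsLeftSubtractive (S : Type u) [Semiring S] : Prop :=
  IsSubtractiveSemimodule S S

/-- `S` is a right CP-semiring if every cyclic right `S`-semimodule, that is, every homomorphic
image of the regular right semimodule `S`, is projective. (A homomorphic image of `S` always has
an isomorphic copy in the universe of `S`.) -/
def IsRightCPSemiring (S : Type u) [Semiring S] : Prop :=
  ∀ (M : Type u) [AddCommMonoid M] [Module Sᵐᵒᵖ M],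
    (∃ f : S →ₗ[Sᵐᵒᵖ] M, Function.Surjective f) → Module.Projective Sᵐᵒᵖ M

/-- `S` is a left CP-semiring if every cyclic left `S`-semimodule is projective. -/
def IsLeftCPSemiring (S : Type u) [Semiring S] : Prop :=
  ∀ (M : Type u) [AddCommMonoid M] [Module S M],
    (∃ f : S →ₗ[S] M, Function.Surjective f) → Module.Projective S M

/-- The semiring `T` is a Boolean algebra: its underlying set carries a Boolean algebra structure
whose join, meet, bottom and top are the sum, product, zero and one of `T`. -/
def IsBooleanAlgebraSemiring (T : Type u) [Semiring T] : Prop :=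
  ∃ _ : BooleanAlgebra T, (∀ a b : T, a + b = a ⊔ b) ∧ (∀ a b : T, a * b = a ⊓ b) ∧
    (0 : T) = ⊥ ∧ (1 : T) = ⊤

/-- `S` is the direct sum of a semisimple ring and a finite Boolean algebra
(either of which may be zero). -/
def IsSemisimpleRingDirectSumFiniteBooleanAlgebra (S : Type u) [Semiring S] : Prop :=
  ∃ (R T : Type u) (_ : Ring R) (_ : Semiring T),
    IsSemisimpleRing R ∧ Finite T ∧ IsBooleanAlgebraSemiring T ∧ Nonempty (S ≃+* R × T)

/-! If `S/c` is projective, a section of `S → S/c` sends the class of `1` to some `e ≡ 1` such that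
right multiplication by `e` identifies `c`-related elements. The proof chooses congruences and reads
off `e`. For the Bourne congruence of a left ideal, subtractivity makes the ideal equal to `{x | x *
f = 0}` with `f` idempotent (`SplitsLeftCongruences.exists_annihilator`). For the ideal of
additively invertible elements this gives `1 = e + v`, and `e`, `v` prove to be central orthogonal
idempotents. The corner of `v` is a ring whose left ideals are kernels of idempotents, hence
semisimple. The corner of `e` is zerosumfree: three congruences give `1 + 1 = 1`, then `1 + a = 1`,
then complements, so it is a Boolean algebra. Its ideals are principal, so the ascending chain
condition makes it finite. Conversely, both kinds of summand split congruences, and splitting passes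
to products. The right-handed case follows by passing to the opposite semiring. -/

/-- Every left congruence `c` of `S` is given by right multiplication with an element `e`
congruent to `1`: equivalently, every cyclic left `S`-semimodule is a retract of `S`. -/
def SplitsLeftCongruences (S : Type u) [Semiring S] : Prop :=
  ∀ c : ModuleCon S S, ∃ e : S, c.r e 1 ∧ ∀ a b : S, c.r a b → a * e = b * e

/-! ### Cyclic projectivity as splitting of congruences -/

section Cyclic

variable {S : Type u} [Semiring S]

/-- The kernel congruence of a linear map. -/
def LinearMap.kerCon {M : Type u} [AddCommMonoid M] [Module S M] (f : S →ₗ[S] M) :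
    ModuleCon S S where
  r a b := f a = f b
  iseqv := ⟨fun _ => rfl, fun h => h.symm, fun h h' => h.trans h'⟩
  add' h h' := by
    rw [map_add, map_add]
    exact congrArg₂ _ h h'
  smul s _ _ h := by
    rw [map_smul, map_smul]
    exact congrArg _ h

theorem isLeftCPSemiring_of_splitsLeftCongruences (h : SplitsLeftCongruences S) :
    IsLeftCPSemiring S := by
  rintro M _ _ ⟨f, hf⟩
  obtain ⟨e, he, hmul⟩ := h f.kerCon
  let g : M →ₗ[S] S :=
    { toFun := fun m => Function.surjInv hf m * e
      map_add' := fun x y => by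
        rw [← add_mul]
        apply hmul
        change f _ = f _
        simp [Function.surjInv_eq hf]
      map_smul' := fun s x => by
        rw [RingHom.id_apply, smul_eq_mul, ← mul_assoc]
        apply hmul
        change f _ = f (s • _)
        rw [map_smul, Function.surjInv_eq hf, Function.surjInv_eq hf] }
  refine Module.Projective.of_split g f (LinearMap.ext fun m => ?_)
  change f (Function.surjInv hf m • e) = m
  have he' : f e = f 1 := he
  rw [map_smul, he', ← map_smul, smul_eq_mul, mul_one, Function.surjInv_eq hf]

theorem splitsLeftCongruences_of_isLeftCPSemiring (h : IsLeftCPSemiring S) :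
    SplitsLeftCongruences S := by
  intro c
  let f : S →ₗ[S] c.Quotient :=
    { toFun := fun s => Quotient.mk c.toSetoid s
      map_add' := fun _ _ => rfl
      map_smul' := fun _ _ => rfl }
  have hf : Function.Surjective f := Quotient.mk_surjective
  have := h c.Quotient ⟨f, hf⟩
  obtain ⟨g, hg⟩ := Module.projective_lifting_property f LinearMap.id hf
  have hg' : ∀ a, g (f a) = a * g (f 1) := fun a => by
    rw [← smul_eq_mul, ← map_smul, ← map_smul, smul_eq_mul, mul_one]
  refine ⟨g (f 1), Quotient.exact (LinearMap.congr_fun hg (f 1)), fun a b hab => ?_⟩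
  rw [← hg', ← hg', show f a = f b from Quotient.sound hab]

theorem isLeftCPSemiring_iff_splitsLeftCongruences :
    IsLeftCPSemiring S ↔ SplitsLeftCongruences S :=
  ⟨splitsLeftCongruences_of_isLeftCPSemiring, isLeftCPSemiring_of_splitsLeftCongruences⟩

end Cyclic

/-! ### Homomorphic images and products -/

section Transfer

variable {S : Type u} {T : Type u} [Semiring S] [Semiring T]

theorem SplitsLeftCongruences.of_surjective (h : SplitsLeftCongruences S) (φ : S →+* T)
    (hφ : Function.Surjective φ) : SplitsLeftCongruences T := by
  intro c
  obtain ⟨e, he, hmul⟩ := h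
    { r := fun a b => c.r (φ a) (φ b)
      iseqv := ⟨fun _ => c.iseqv.refl _, fun h => c.iseqv.symm h, fun h h' => c.iseqv.trans h h'⟩
      add' := fun h h' => by
        rw [map_add, map_add]
        exact c.add' h h'
      smul := fun s _ _ h => by
        rw [smul_eq_mul, smul_eq_mul, map_mul, map_mul]
        exact c.smul (φ s) h }
  refine ⟨φ e, ?_, fun a b hab => ?_⟩
  · rw [← map_one φ]
    exact he
  obtain ⟨a, rfl⟩ := hφ a
  obtain ⟨b, rfl⟩ := hφ b
  rw [← map_mul, ← map_mul, hmul a b hab]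

theorem IsLeftSubtractive.of_surjective (h : IsLeftSubtractive S) (φ : S →+* T)
    (hφ : Function.Surjective φ) : IsLeftSubtractive T := by
  intro K m m' hm hmm'
  obtain ⟨m, rfl⟩ := hφ m
  obtain ⟨m', rfl⟩ := hφ m'
  let K' : Submodule S S :=
    { carrier := {x | φ x ∈ K}
      add_mem' := fun {a b} ha hb => by
        change φ (a + b) ∈ K
        rw [map_add]
        exact K.add_mem ha hb
      zero_mem' := by
        change φ 0 ∈ K
        rw [map_zero]
        exact K.zero_mem
      smul_mem' := fun s x hx => by
        change φ (s * x) ∈ K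
        rw [map_mul]
        exact K.smul_mem (φ s) hx }
  refine h K' m m' hm ?_
  change φ (m + m') ∈ K
  rwa [map_add]

theorem SplitsLeftCongruences.prod (hS : SplitsLeftCongruences S)
    (hT : SplitsLeftCongruences T) : SplitsLeftCongruences (S × T) := by
  intro c
  obtain ⟨e, he, hmul⟩ := hS
    { r := fun a b => c.r (a, 0) (b, 0)
      iseqv := ⟨fun _ => c.iseqv.refl _, fun h => c.iseqv.symm h, fun h h' => c.iseqv.trans h h'⟩
      add' := fun h h' => by simpa using c.add' h h'
      smul := fun s _ _ h => by simpa using c.smul (s, 0) h }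
  obtain ⟨f, hf, hmul'⟩ := hT
    { r := fun a b => c.r (0, a) (0, b)
      iseqv := ⟨fun _ => c.iseqv.refl _, fun h => c.iseqv.symm h, fun h h' => c.iseqv.trans h h'⟩
      add' := fun h h' => by simpa using c.add' h h'
      smul := fun s _ _ h => by simpa using c.smul (0, s) h }
  refine ⟨(e, f), by simpa [← Prod.one_eq_mk] using c.add' he hf, fun a b hab => Prod.ext ?_ ?_⟩
  · exact hmul _ _ (by simpa [Prod.mul_def] using c.smul (1, 0) hab)
  · exact hmul' _ _ (by simpa [Prod.mul_def] using c.smul (0, 1) hab)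

end Transfer

/-! ### Left ideals as annihilators of idempotents -/

/-- The Bourne congruence of a left ideal. -/
def bourneCon {S : Type u} [Semiring S] (K : Submodule S S) : ModuleCon S S where
  r a b := ∃ k ∈ K, ∃ k' ∈ K, a + k = b + k'
  iseqv :=
    { refl := fun _ => ⟨0, K.zero_mem, 0, K.zero_mem, rfl⟩
      symm := fun ⟨k, hk, k', hk', h⟩ => ⟨k', hk', k, hk, h.symm⟩
      trans := fun ⟨k, hk, k', hk', h⟩ ⟨l, hl, l', hl', h'⟩ =>
        ⟨k + l, K.add_mem hk hl, k' + l', K.add_mem hk' hl', by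
          rw [← add_assoc, h, add_right_comm, h', add_right_comm, add_assoc]⟩ }
  add' := fun ⟨k, hk, k', hk', h⟩ ⟨l, hl, l', hl', h'⟩ =>
    ⟨k + l, K.add_mem hk hl, k' + l', K.add_mem hk' hl', by
      rw [add_add_add_comm, h, h', add_add_add_comm]⟩
  smul := fun s _ _ ⟨k, hk, k', hk', h⟩ =>
    ⟨s * k, K.smul_mem s hk, s * k', K.smul_mem s hk', by
      simp only [smul_eq_mul, ← mul_add, h]⟩

theorem SplitsLeftCongruences.exists_annihilator {S : Type u} [Semiring S]
    (hS : SplitsLeftCongruences S) (hsub : IsLeftSubtractive S) (K : Submodule S S) :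
    ∃ f : S, f * f = f ∧ (∀ x, x ∈ K ↔ x * f = 0) ∧ ∃ k ∈ K, ∃ k' ∈ K, 1 + k = f + k' := by
  obtain ⟨f, ⟨k', hk', k, hk, hf⟩, hmul⟩ := hS (bourneCon K)
  refine ⟨f, by simpa using hmul f 1 ⟨k', hk', k, hk, hf⟩, fun x => ⟨fun hx => ?_, fun hx => ?_⟩,
    k, hk, k', hk', hf.symm⟩
  · simpa using hmul x 0 ⟨0, K.zero_mem, x, hx, by simp⟩
  -- Multiplying `f + k' = 1 + k` by `x` kills `f`, leaving `x * k' = x + x * k`; subtractivity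
  -- removes `x * k`.
  · refine hsub K (x * k) x (K.smul_mem x hk) ?_
    have h : x * k + x = x * k' := by
      have := congrArg (x * ·) hf
      simp only [mul_add, hx, mul_one, zero_add] at this
      rw [this, add_comm]
    rw [h]
    exact K.smul_mem x hk'

/-! ### Zerosumfree semirings are Boolean algebras -/

section ZeroSumFree

variable {S : Type u} [Semiring S]

/-- The congruence identifying elements which are bounded by multiples of each other. -/
def archimedeanCon (S : Type u) [Semiring S] : ModuleCon S S where
  r a b := (∃ (n : ℕ) (c : S), a + c = n • b) ∧ ∃ (n : ℕ) (c : S), b + c = n • a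
  iseqv :=
    { refl := fun a => ⟨⟨1, 0, by simp⟩, ⟨1, 0, by simp⟩⟩
      symm := fun h => ⟨h.2, h.1⟩
      trans := by
        have key : ∀ {a b x : S}, (∃ (n : ℕ) (c : S), a + c = n • b) →
            (∃ (n : ℕ) (c : S), b + c = n • x) → ∃ (n : ℕ) (c : S), a + c = n • x := by
          rintro a b x ⟨n, c, h⟩ ⟨m, d, h'⟩
          exact ⟨n * m, c + n • d, by rw [← add_assoc, h, ← smul_add, h', mul_smul]⟩
        exact fun {_ _ _} h h' => ⟨key h.1 h'.1, key h'.2 h.2⟩ }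
  add' := by
    have key : ∀ {a b a' b' : S}, (∃ (n : ℕ) (c : S), a + c = n • b) →
        (∃ (n : ℕ) (c : S), a' + c = n • b') →
        ∃ (n : ℕ) (c : S), (a + a') + c = n • (b + b') := by
      rintro a b a' b' ⟨n, c, h⟩ ⟨m, d, h'⟩
      refine ⟨n + m, (c + m • b) + (d + n • b'), ?_⟩
      rw [add_add_add_comm, ← add_assoc a, h, ← add_assoc a', h', add_comm (m • b'),
        add_add_add_comm, ← smul_add, ← smul_add, ← add_smul]
    exact fun {_ _ _ _} h h' => ⟨key h.1 h'.1, key h.2 h'.2⟩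
  smul := by
    have key : ∀ (s : S) {a b : S}, (∃ (n : ℕ) (c : S), a + c = n • b) →
        ∃ (n : ℕ) (c : S), s • a + c = n • (s • b) := by
      rintro s a b ⟨n, c, h⟩
      exact ⟨n, s • c, by rw [← smul_add, h, smul_comm]⟩
    exact fun s {_ _} h => ⟨key s h.1, key s h.2⟩

/-- In a zerosumfree semiring, having the same left annihilator is a left congruence. -/
def annihilatorCon (hz : ∀ a b : S, a + b = 0 → a = 0) : ModuleCon S S where
  r a b := ∀ x : S, x * a = 0 ↔ x * b = 0
  iseqv := ⟨fun _ _ => Iff.rfl, fun h x => (h x).symm, fun h h' x => (h x).trans (h' x)⟩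
  add' := by
    have key : ∀ x a b : S, x * (a + b) = 0 ↔ x * a = 0 ∧ x * b = 0 := fun x a b =>
      ⟨fun h => by
        rw [mul_add] at h
        exact ⟨hz _ _ h, hz _ _ (by rwa [add_comm] at h)⟩,
      fun h => by rw [mul_add, h.1, h.2, add_zero]⟩
    intro _ _ _ _ h h' x
    rw [key, key, h x, h' x]
  smul s _ _ h x := by
    rw [smul_eq_mul, smul_eq_mul, ← mul_assoc, ← mul_assoc]
    exact h (x * s)

/-- Since `1 + 1` and `1` are archimedean equivalent, `e + e = e`. Since `1` is bounded by a
multiple of `e`, whatever `e` kills on its right is zero, so `S e` is all of `S` and `1` inherits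
additive idempotence. -/
theorem add_self_of_zeroSumFree (hS : SplitsLeftCongruences S) (hsub : IsLeftSubtractive S)
    (hz : ∀ a b : S, a + b = 0 → a = 0) (a : S) : a + a = a := by
  obtain ⟨e, ⟨-, n, c, he⟩, hmul⟩ := hS (archimedeanCon S)
  have h2 : e + e = e := by
    have := hmul (1 + 1) 1 ⟨⟨2, 0, by rw [add_zero, two_smul]⟩, ⟨1, 1, by rw [one_smul]⟩⟩
    rwa [add_mul, one_mul] at this
  obtain ⟨f, -, hf, -⟩ := hS.exists_annihilator hsub (Submodule.span S {e})
  have hef : e * f = 0 := (hf e).1 (Submodule.mem_span_singleton_self e)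
  have hf0 : f = 0 := hz f (c * f) (by
    have := congrArg (· * f) he
    simpa only [add_mul, one_mul, smul_mul_assoc, hef, smul_zero] using this)
  obtain ⟨s, hs⟩ := Submodule.mem_span_singleton.1 ((hf 1).2 (by rw [hf0, mul_zero]))
  rw [smul_eq_mul] at hs
  have h1 : (1 : S) + 1 = 1 := by
    rw [← hs, ← mul_add, h2]
  rw [← mul_one a, ← mul_add, h1]

/-- Used with `b` idempotent: an element `a` absorbed by `b` then satisfies `a = a * b`. -/
theorem exists_eq_mul_of_add_eq (hsub : IsLeftSubtractive S) {a b : S} (h : a + b = b) :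
    ∃ x, a = x * b := by
  have hb := Submodule.mem_span_singleton_self (R := S) b
  obtain ⟨x, hx⟩ := Submodule.mem_span_singleton.1
    (hsub (Submodule.span S {b}) b a hb (by rwa [add_comm, h]))
  exact ⟨x, hx.symm⟩

/-- By zerosumfreeness `1 + a` and `1` have the same left annihilator, so `e` absorbs every `a * e`.
It remains to prove `e = 1`. -/
theorem one_add_of_zeroSumFree (hS : SplitsLeftCongruences S) (hsub : IsLeftSubtractive S)
    (hz : ∀ a b : S, a + b = 0 → a = 0) (a : S) : 1 + a = 1 := by
  have hadd := add_self_of_zeroSumFree hS hsub hz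
  obtain ⟨e, he, hmul⟩ := hS (annihilatorCon hz)
  have hee : e * e = e := by simpa using hmul e 1 he
  have hann : ∀ x, x * e = 0 → x = 0 := fun x hx => by simpa using (he x).1 hx
  have htop : ∀ a, e + a * e = e := fun a => by
    have := hmul (1 + a) 1 fun x => ⟨fun h => by
      rw [mul_add] at h
      exact hz _ _ h, fun h => by
      rw [mul_one] at h
      rw [h, zero_mul]⟩
    rwa [add_mul, one_mul] at this
  obtain ⟨y, hy⟩ := exists_eq_mul_of_add_eq hsub (a := 1) (b := 1 + e) (by rw [← add_assoc, hadd])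
  rw [mul_add, mul_one] at hy
  have hye : y * e = e := by
    have := congrArg (· * e) hy
    simp only [add_mul, one_mul, mul_assoc, hee, hadd] at this
    exact this.symm
  rw [hye] at hy
  have he1 : e + 1 = 1 := by rw [hy, add_left_comm, hadd]
  obtain ⟨f, hff, hf, k, hk, k', hk', hkf⟩ :=
    hS.exists_annihilator hsub (Submodule.span S {e})
  have hef : e * f = 0 := (hf e).1 (Submodule.mem_span_singleton_self e)
  obtain ⟨u, rfl⟩ := Submodule.mem_span_singleton.1 hk
  obtain ⟨w, rfl⟩ := Submodule.mem_span_singleton.1 hk'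
  simp only [smul_eq_mul] at hkf
  have h1 : 1 = f + w * e := by
    rw [← hkf]
    nth_rewrite 2 [← he1]
    rw [add_right_comm, htop, he1]
  have hf1 : f + 1 = 1 := by rw [h1, ← add_assoc, hadd]
  -- As `e + 1 = 1`, `f` absorbs `f * e`; hence `f * e = f * e * f`, which vanishes because `e * f =
  -- 0`.
  have hfe : f * e = 0 := by
    obtain ⟨x, hx⟩ := exists_eq_mul_of_add_eq hsub (a := f * e) (b := f) (by
      nth_rewrite 2 [← mul_one f]
      rw [← mul_add, he1, mul_one])
    have : f * e = f * e * f := by rw [hx, mul_assoc, hff]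
    rw [this, mul_assoc, hef, mul_zero]
  rw [hann f hfe, zero_add] at h1
  have hone : e = 1 := by
    rw [h1]
    nth_rewrite 1 [← one_mul e]
    rw [h1, mul_assoc, hee]
  have := htop a
  rwa [hone, mul_one] at this

theorem exists_compl_of_zeroSumFree (hS : SplitsLeftCongruences S) (hsub : IsLeftSubtractive S)
    (hz : ∀ a b : S, a + b = 0 → a = 0) (a : S) : ∃ f, a + f = 1 ∧ a * f = 0 ∧ f * a = 0 := by
  have htop := one_add_of_zeroSumFree hS hsub hz
  obtain ⟨f, hff, hf, k, hk, k', hk', hkf⟩ :=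
    hS.exists_annihilator hsub (Submodule.span S {a})
  have haf : a * f = 0 := (hf a).1 (Submodule.mem_span_singleton_self a)
  obtain ⟨w, rfl⟩ := Submodule.mem_span_singleton.1 hk'
  rw [htop, smul_eq_mul] at hkf
  refine ⟨f, ?_, haf, ?_⟩
  · have : w * a + a = a := by
      nth_rewrite 2 [← one_mul a]
      rw [← add_mul, add_comm w, htop, one_mul]
    rw [← htop a, hkf, add_assoc, this, add_comm]
  · obtain ⟨x, hx⟩ := exists_eq_mul_of_add_eq hsub (a := f * a) (b := f) (by
      nth_rewrite 2 [← mul_one f]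
      rw [← mul_add, add_comm, htop, mul_one])
    have : f * a = f * a * f := by rw [hx, mul_assoc, hff]
    rw [this, mul_assoc, haf, mul_zero]

theorem isNoetherian_of_zeroSumFree (hS : SplitsLeftCongruences S) (hsub : IsLeftSubtractive S)
    (hz : ∀ a b : S, a + b = 0 → a = 0) : IsNoetherian S S := by
  refine ⟨fun K => ?_⟩
  obtain ⟨f, -, hf, k, -, k', hk', hkf⟩ := hS.exists_annihilator hsub K
  rw [one_add_of_zeroSumFree hS hsub hz] at hkf
  -- Since `1 = f + k'` and `f` is killed by `K`, each `x ∈ K` equals `x * k'`.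
  refine ⟨{k'}, le_antisymm (by simpa [Submodule.span_le] using hk') fun x hx => ?_⟩
  refine Submodule.mem_span.2 fun p hp => ?_
  have : x = x • k' := by
    rw [smul_eq_mul]
    nth_rewrite 1 [← mul_one x]
    rw [hkf, mul_add, (hf x).1 hx, zero_add]
  rw [this]
  exact p.smul_mem x (hp (by simp))

theorem isBooleanAlgebraSemiring_of_zeroSumFree (hS : SplitsLeftCongruences S)
    (hsub : IsLeftSubtractive S) (hz : ∀ a b : S, a + b = 0 → a = 0) :
    IsBooleanAlgebraSemiring S := by
  have hadd := add_self_of_zeroSumFree hS hsub hz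
  have htop := one_add_of_zeroSumFree hS hsub hz
  choose compl hc1 hc2 hc3 using exists_compl_of_zeroSumFree hS hsub hz
  have hmul : ∀ a : S, a * a = a := fun a => by
    have := congrArg (a * ·) (hc1 a)
    simpa only [mul_add, hc2, add_zero, mul_one] using this
  have hl : ∀ a b : S, a * b + a = a := fun a b => by
    nth_rewrite 2 [← mul_one a]
    rw [← mul_add, add_comm, htop, mul_one]
  have hr : ∀ a b : S, a * b + b = b := fun a b => by
    nth_rewrite 2 [← one_mul b]
    rw [← add_mul, add_comm, htop, one_mul]
  have htrans : ∀ a b c : S, a + b = b → b + c = c → a + c = c := fun a b c h h' => by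
    rw [← h', ← add_assoc, h]
  have hsup : ∀ a b c : S, a + c = c → b + c = c → a + b + c = c := fun a b c h h' => by
    rw [add_assoc, h', h]
  have hinf : ∀ a b c : S, a + b = b → a + c = c → a + b * c = b * c := fun a b c h h' => by
    have h1 : a + a * c = a * c := by
      nth_rewrite 1 [← hmul a]
      rw [← mul_add, h']
    have h2 : a * c + b * c = b * c := by rw [← add_mul, h]
    exact htrans _ _ _ h1 h2
  refine ⟨{
    le := fun a b => a + b = b
    le_refl := hadd
    le_trans := htrans
    le_antisymm := fun a b h h' => by
      rw [← h', add_comm]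
      exact h
    sup := fun a b => a + b
    inf := fun a b => a * b
    le_sup_left := fun a b => by
      rw [← add_assoc, hadd]
    le_sup_right := fun a b => by
      rw [add_left_comm, hadd]
    sup_le := hsup
    inf_le_left := hl
    inf_le_right := hr
    le_inf := hinf
    le_sup_inf := fun a b c => by
      change (a + b) * (a + c) + (a + b * c) = a + b * c
      rw [add_mul, mul_add b, ← add_assoc, ← add_assoc]
      have h1 : a * (a + c) + a = a := hl _ _
      have h2 : b * a + a = a := hr _ _
      calc a * (a + c) + b * a + b * c + a + b * c
          = (a * (a + c) + (b * a + a)) + (b * c + b * c) := by ac_rfl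
        _ = a + b * c := by rw [h2, h1, hadd]
    top := 1
    bot := 0
    compl := compl
    le_top := fun a => by
      rw [add_comm, htop]
    bot_le := fun a => zero_add a
    inf_compl_le_bot := fun a => by
      change a * compl a + 0 = 0
      rw [hc2, zero_add]
    top_le_sup_compl := fun a => by
      change 1 + (a + compl a) = a + compl a
      rw [hc1, hadd] }, fun _ _ => rfl, fun _ _ => rfl, rfl, rfl⟩

end ZeroSumFree

/-! ### Finiteness from chain conditions -/

theorem BooleanAlgebra.finite_of_wellFoundedLT (α : Type u) [BooleanAlgebra α]
    [WellFoundedLT α] : Finite α := by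
  have h : ∀ a : α, (Set.Iic a).Finite := fun a => by
    induction a using WellFoundedLT.induction with
    | ind a ih =>
      -- Unless `a` is an atom or `⊥`, it splits into strictly smaller `b` and `a \ b`, and elements
      -- below `a` are joins of elements below these.
      by_cases hb : ∃ b, b < a ∧ b ≠ ⊥
      · obtain ⟨b, hba, hb⟩ := hb
        refine (((ih b hba).prod (ih (a \ b) (sdiff_lt hba.le hb))).image
          fun p => p.1 ⊔ p.2).subset fun x hx => ?_
        refine ⟨(x ⊓ b, x \ b), ⟨inf_le_right, sdiff_le_sdiff_right hx⟩, ?_⟩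
        exact sup_inf_sdiff x b
      · push Not at hb
        refine (Set.toFinite {⊥, a}).subset fun x hx => ?_
        rcases (Set.mem_Iic.1 hx).lt_or_eq with h | h
        · exact Or.inl (hb x h)
        · exact Or.inr h
  exact Set.finite_univ_iff.1 ((h ⊤).subset fun x _ => Set.mem_Iic.2 (le_top x))

theorem IsBooleanAlgebraSemiring.finite_of_isNoetherian {T : Type u} [Semiring T]
    (hT : IsBooleanAlgebraSemiring T) [IsNoetherian T T] : Finite T := by
  obtain ⟨_, -, hmul, -, -⟩ := hT
  have hmono : StrictMono fun a : T => Submodule.span T {a} := by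
    have hle : ∀ a b : T, Submodule.span T {a} ≤ Submodule.span T {b} ↔ a ≤ b := fun a b => by
      rw [Submodule.span_singleton_le_iff_mem, Submodule.mem_span_singleton]
      refine ⟨?_, fun h => ⟨a, by rw [smul_eq_mul, hmul, inf_eq_left.2 h]⟩⟩
      rintro ⟨x, rfl⟩
      rw [smul_eq_mul, hmul]
      exact inf_le_right
    intro a b hab
    exact lt_of_le_not_ge ((hle a b).2 hab.le) fun h => hab.not_ge ((hle b a).1 h)
  have : WellFoundedGT T := hmono.wellFoundedGT
  have : WellFoundedLT T := (compl_strictAnti T).wellFoundedLT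
  exact BooleanAlgebra.finite_of_wellFoundedLT T

/-! ### Splitting in semisimple rings and finite Boolean algebras -/

section SemisimpleRing

theorem isSemisimpleRing_of_splitsLeftCongruences {R : Type u} [Ring R]
    (hR : SplitsLeftCongruences R) : IsSemisimpleRing R := by
  have hsub : IsLeftSubtractive R := fun K m m' hm h => by
    simpa using K.sub_mem h hm
  refine (isSemisimpleModule_iff R R).2 ⟨fun K => ?_⟩
  obtain ⟨f, hff, hf, -⟩ := hR.exists_annihilator hsub K
  have hp : IsIdempotentElem (LinearMap.toSpanSingleton R R f) := LinearMap.ext fun x => by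
    change (x * f) * f = x * f
    rw [mul_assoc, hff]
  have hK : K = LinearMap.ker (LinearMap.toSpanSingleton R R f) := Submodule.ext hf
  rw [hK]
  exact ⟨_, (LinearMap.IsIdempotentElem.isCompl hp).symm⟩

theorem splitsLeftCongruences_of_isSemisimpleRing {R : Type u} [Ring R] [IsSemisimpleRing R] :
    SplitsLeftCongruences R := by
  intro c
  let K : Submodule R R :=
    { carrier := {x | c.r x 0}
      add_mem' := fun {a b} ha hb => by simpa using c.add' ha hb
      zero_mem' := c.iseqv.refl 0
      smul_mem' := fun s x hx => by simpa using c.smul s hx }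
  obtain ⟨L, hKL⟩ := exists_isCompl K
  obtain ⟨k, hk, e, he, hke⟩ := Submodule.mem_sup.1
    (hKL.sup_eq_top ▸ Submodule.mem_top : (1 : R) ∈ K ⊔ L)
  refine ⟨e, ?_, fun a b hab => ?_⟩
  · have := c.add' hk (c.iseqv.refl e)
    rw [hke, zero_add] at this
    exact c.iseqv.symm this
  · have hab' : a - b ∈ K := by
      have := c.add' hab (c.iseqv.refl (-b))
      rwa [add_neg_cancel, ← sub_eq_add_neg] at this
    have hmem : (a - b) * e ∈ K := by
      have : (a - b) * e = (a - b) - (a - b) * k := by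
        rw [eq_sub_iff_add_eq', ← mul_add, hke, mul_one]
      rw [this]
      exact K.sub_mem hab' (K.smul_mem _ hk)
    have := Submodule.disjoint_def.1 hKL.disjoint _ hmem (L.smul_mem (a - b) he)
    rwa [sub_mul, sub_eq_zero] at this

theorem IsBooleanAlgebraSemiring.splitsLeftCongruences {T : Type u} [Semiring T] [Finite T]
    (hT : IsBooleanAlgebraSemiring T) : SplitsLeftCongruences T := by
  obtain ⟨_, hadd, hmul, hzero, hone⟩ := hT
  intro c
  obtain ⟨e, he, hmin⟩ := (Set.toFinite {t : T | c.r t 1}).exists_minimal ⟨1, c.iseqv.refl 1⟩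
  -- The class of `1` is closed under meets, so a minimal member is its least element.
  have hle : ∀ t, c.r t 1 → e ≤ t := fun t ht => by
    have h : c.r (e * t) 1 := by
      have := c.smul e ht
      simp only [smul_eq_mul, mul_one] at this
      exact c.iseqv.trans this he
    rw [hmul] at h
    exact (hmin h inf_le_left).trans inf_le_right
  have key : ∀ a b, c.r a b → b * e ≤ a * e := fun a b hab => by
    have h := c.add' hab (c.iseqv.refl bᶜ)
    rw [hadd b, sup_compl_eq_top, ← hone, hadd] at h
    rw [hmul, hmul]
    refine le_inf ?_ inf_le_right
    calc b ⊓ e ≤ b ⊓ (a ⊔ bᶜ) := inf_le_inf_left _ (hle _ h)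
      _ = b ⊓ a := by rw [inf_sup_left, inf_compl_self, sup_bot_eq]
      _ ≤ a := inf_le_right
  exact ⟨e, he, fun a b hab => le_antisymm (key b a (c.iseqv.symm hab)) (key a b hab)⟩

end SemisimpleRing

/-! ### Splitting off the ring of additively invertible elements -/

section Decomposition

variable {S : Type u} [Semiring S]

/-- A pair of complementary orthogonal central idempotents decomposes a semiring as a product. -/
def ringEquivCornerProd {e v : S} (he : IsIdempotentElem e) (hv : IsIdempotentElem v)
    (hadd : e + v = 1) (hev : e * v = 0) (hve : v * e = 0) (hce : ∀ x, e * x = x * e)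
    (hcv : ∀ x, v * x = x * v) : S ≃+* hv.Corner × he.Corner where
  toFun x := (⟨v * x * v, x, rfl⟩, ⟨e * x * e, x, rfl⟩)
  invFun p := p.1.1 + p.2.1
  left_inv x := by
    change v * x * v + e * x * e = x
    rw [hcv, hce, mul_assoc, mul_assoc, hv.eq, he.eq, ← mul_add, add_comm, hadd, mul_one]
  right_inv := by
    rintro ⟨⟨_, x, rfl⟩, ⟨_, y, rfl⟩⟩
    refine Prod.ext (Subtype.ext ?_) (Subtype.ext ?_)
    · change v * (v * x * v + e * y * e) * v = v * x * v
      simp only [mul_add, add_mul, mul_assoc, hv.eq, hev, mul_zero, add_zero]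
      rw [← mul_assoc v v, hv.eq]
    · change e * (v * x * v + e * y * e) * e = e * y * e
      simp only [mul_add, add_mul, mul_assoc, he.eq, hve, mul_zero, zero_add]
      rw [← mul_assoc e e, he.eq]
  map_add' x y := by
    refine Prod.ext (Subtype.ext ?_) (Subtype.ext ?_)
    · change v * (x + y) * v = v * x * v + v * y * v
      rw [mul_add, add_mul]
    · change e * (x + y) * e = e * x * e + e * y * e
      rw [mul_add, add_mul]
  map_mul' x y := by
    refine Prod.ext (Subtype.ext ?_) (Subtype.ext ?_)
    · change v * (x * y) * v = v * x * v * (v * y * v)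
      rw [hcv, hcv x, hcv y]
      simp only [mul_assoc, hv.eq]
      rw [← mul_assoc v y, hcv y]
      simp only [mul_assoc, hv.eq]
    · change e * (x * y) * e = e * x * e * (e * y * e)
      rw [hce, hce x, hce y]
      simp only [mul_assoc, he.eq]
      rw [← mul_assoc e y, hce y]
      simp only [mul_assoc, he.eq]

/-- A semiring all of whose elements have additive inverses is a ring. -/
noncomputable abbrev Ring.ofExistsNeg (R : Type u) [Semiring R]
    (h : ∀ a : R, ∃ b, a + b = 0) : Ring R where
  neg a := (h a).choose
  zsmul := @zsmulRec R _ _ ⟨fun a => (h a).choose⟩ nsmulRec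
  neg_add_cancel a := by
    rw [add_comm]
    exact (h a).choose_spec

/-- The ideal of elements having an additive inverse. -/
def negatableIdeal (S : Type u) [Semiring S] : Submodule S S where
  carrier := {a | ∃ b, a + b = 0}
  add_mem' := fun ⟨c, hc⟩ ⟨d, hd⟩ => ⟨c + d, by rw [add_add_add_comm, hc, hd, add_zero]⟩
  zero_mem' := ⟨0, add_zero 0⟩
  smul_mem' := fun s _ ⟨c, hc⟩ => ⟨s * c, by rw [smul_eq_mul, ← mul_add, hc, mul_zero]⟩

/-- A left ideal all of whose elements have additive inverses is cut out by a decomposition of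
the identity. -/
theorem exists_add_eq_one_of_le_negatableIdeal (hS : SplitsLeftCongruences S)
    (hsub : IsLeftSubtractive S) {K : Submodule S S} (hK : K ≤ negatableIdeal S) :
    ∃ f n : S, n ∈ K ∧ f + n = 1 ∧ f * f = f ∧ ∀ x, x ∈ K ↔ x * f = 0 := by
  obtain ⟨f, hff, hf, k, hk, k', hk', h⟩ := hS.exists_annihilator hsub K
  -- Adding the negative `l` of `k` to `1 + k = f + k'` cancels `k`; subtractivity keeps `l` in `K`.
  obtain ⟨l, hl⟩ := hK hk
  refine ⟨f, k' + l, K.add_mem hk' (hsub K k l hk (by simp [hl])), ?_, hff, hf⟩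
  rw [← add_assoc, ← h, add_assoc, hl, add_zero]

theorem isSemisimpleRingDirectSumFiniteBooleanAlgebra_of_splitsLeftCongruences
    (hS : SplitsLeftCongruences S) (hsub : IsLeftSubtractive S) :
    IsSemisimpleRingDirectSumFiniteBooleanAlgebra S := by
  obtain ⟨e, v, hv, hadd, hee, hmem⟩ := exists_add_eq_one_of_le_negatableIdeal hS hsub le_rfl
  have hve : v * e = 0 := (hmem v).1 hv
  have hvv : v * v = v := by
    have := congrArg (v * ·) hadd
    simpa only [mul_add, hve, zero_add, mul_one] using this
  have hright : ∀ {a : S} (x : S), a ∈ negatableIdeal S → a * x ∈ negatableIdeal S :=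
    fun x ⟨b, hb⟩ => ⟨b * x, by rw [← add_mul, hb, zero_mul]⟩
  have hvxe : ∀ x, v * x * e = 0 := fun x => (hmem _).1 (hright x hv)
  have hev : e * v = 0 := by
    obtain ⟨w, hw⟩ := (negatableIdeal S).smul_mem e hv
    rw [smul_eq_mul] at hw
    -- An additively invertible element that is additively idempotent is zero.
    have h : e * v + e * v = e * v := by
      have := congrArg (e * · * v) hadd
      simpa only [mul_add, add_mul, hee, mul_assoc, hvv, one_mul] using this
    have := congrArg (· + w) h
    simpa only [add_assoc, hw, add_zero] using this
  -- The left ideal of `e * x * v` squares to zero because `v * s * e = 0`. Its component `n` of `1`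
  -- satisfies `n = n * (f + n) = 0`, so `f = 1` and the ideal vanishes.
  have hexv : ∀ x, e * x * v = 0 := fun x => by
    have hK : Submodule.span S {e * x * v} ≤ negatableIdeal S := by
      rw [Submodule.span_singleton_le_iff_mem]
      exact (negatableIdeal S).smul_mem (e * x) hv
    obtain ⟨f, n, hn, hfn, -, hf⟩ := exists_add_eq_one_of_le_negatableIdeal hS hsub hK
    have hnf := (hf n).1 hn
    obtain ⟨s, rfl⟩ := Submodule.mem_span_singleton.1 hn
    rw [smul_eq_mul] at hfn hnf
    have hnn : s * (e * x * v) * (s * (e * x * v)) = 0 := by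
      calc s * (e * x * v) * (s * (e * x * v)) = s * (e * x) * (v * s * e) * (x * v) := by
            simp only [mul_assoc]
        _ = 0 := by rw [hvxe, mul_zero, zero_mul]
    have hn0 : s * (e * x * v) = 0 := by
      rw [← mul_one (s * (e * x * v)), ← hfn, mul_add, hnf, hnn, add_zero]
    rw [hn0, add_zero] at hfn
    simpa only [hfn, mul_one] using (hf _).1 (Submodule.mem_span_singleton_self (e * x * v))
  have hce : ∀ x, e * x = x * e := fun x => by
    calc e * x = e * x * (e + v) := by rw [hadd, mul_one]
      _ = (e + v) * x * e := by
        rw [mul_add, hexv, add_zero, add_mul, add_mul, hvxe, add_zero]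
      _ = x * e := by rw [hadd, one_mul]
  have hcv : ∀ x, v * x = x * v := fun x => by
    calc v * x = v * x * (e + v) := by rw [hadd, mul_one]
      _ = (e + v) * x * v := by
        rw [mul_add, hvxe, zero_add, add_mul, add_mul, hexv, zero_add]
      _ = x * v := by rw [hadd, one_mul]
  have he : IsIdempotentElem e := hee
  have hv' : IsIdempotentElem v := hvv
  let φ := ringEquivCornerProd he hv' hadd hev hve hce hcv
  have hφ₁ : Function.Surjective ((RingHom.fst hv'.Corner he.Corner).comp (φ : S →+* _)) :=
    Prod.fst_surjective.comp φ.surjective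
  have hφ₂ : Function.Surjective ((RingHom.snd hv'.Corner he.Corner).comp (φ : S →+* _)) :=
    Prod.snd_surjective.comp φ.surjective
  have hT := hS.of_surjective _ hφ₂
  have hTsub := hsub.of_surjective _ hφ₂
  have hTz : ∀ a b : he.Corner, a + b = 0 → a = 0 := by
    rintro ⟨_, x, rfl⟩ ⟨b, hb⟩ hab
    have : e * x * e * e = 0 := (hmem _).1 ⟨b, congrArg Subtype.val hab⟩
    rw [mul_assoc, hee] at this
    exact Subtype.ext this
  have := isNoetherian_of_zeroSumFree hT hTsub hTz
  have hTbool := isBooleanAlgebraSemiring_of_zeroSumFree hT hTsub hTz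
  have hneg : ∀ a : hv'.Corner, ∃ b, a + b = 0 := by
    rintro ⟨_, x, rfl⟩
    obtain ⟨w, hw⟩ := hright v (hright x hv)
    refine ⟨⟨v * w * v, w, rfl⟩, Subtype.ext ?_⟩
    change v * x * v + v * w * v = 0
    have := congrArg (v * · * v) hw
    simp only [mul_add, add_mul, mul_zero, zero_mul] at this
    rw [← this]
    simp only [← mul_assoc, hvv]
    simp only [mul_assoc, hvv]
  let _ : Ring hv'.Corner := Ring.ofExistsNeg _ hneg
  exact ⟨hv'.Corner, he.Corner, Ring.ofExistsNeg _ hneg, inferInstance,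
    isSemisimpleRing_of_splitsLeftCongruences (hS.of_surjective _ hφ₁),
    hTbool.finite_of_isNoetherian, hTbool, ⟨φ⟩⟩

theorem IsSemisimpleRingDirectSumFiniteBooleanAlgebra.splitsLeftCongruences
    (h : IsSemisimpleRingDirectSumFiniteBooleanAlgebra S) : SplitsLeftCongruences S := by
  obtain ⟨R, T, _, _, _, _, hT, ⟨φ⟩⟩ := h
  exact (splitsLeftCongruences_of_isSemisimpleRing.prod hT.splitsLeftCongruences).of_surjective
    (φ.symm : R × T →+* S) φ.symm.surjective

theorem isLeftCPSemiring_iff_of_isLeftSubtractive (hsub : IsLeftSubtractive S) :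
    IsLeftCPSemiring S ↔ IsSemisimpleRingDirectSumFiniteBooleanAlgebra S := by
  rw [isLeftCPSemiring_iff_splitsLeftCongruences]
  exact ⟨fun h => isSemisimpleRingDirectSumFiniteBooleanAlgebra_of_splitsLeftCongruences h hsub,
    fun h => h.splitsLeftCongruences⟩

end Decomposition

/-! ### Left-right duality -/

section Opposite

open MulOpposite

variable {S : Type u} [Semiring S]

/-- The regular right semimodule of `S` is the regular left semimodule of the opposite
semiring. -/
def regularOpEquiv (S : Type u) [Semiring S] : S ≃ₗ[Sᵐᵒᵖ] Sᵐᵒᵖ where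
  __ := opAddEquiv
  map_smul' _ _ := rfl

theorem isRightCPSemiring_iff_op : IsRightCPSemiring S ↔ IsLeftCPSemiring Sᵐᵒᵖ := by
  refine forall_congr' fun M => forall_congr' fun _ => forall_congr' fun _ =>
    imp_congr_left ⟨fun ⟨f, hf⟩ => ?_, fun ⟨f, hf⟩ => ?_⟩
  · exact ⟨f ∘ₗ (regularOpEquiv S).symm.toLinearMap, hf.comp (regularOpEquiv S).symm.surjective⟩
  · exact ⟨f ∘ₗ (regularOpEquiv S).toLinearMap, hf.comp (regularOpEquiv S).surjective⟩

theorem IsRightSubtractive.op (h : IsRightSubtractive S) : IsLeftSubtractive Sᵐᵒᵖ := by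
  intro K m m' hm hmm'
  exact h (K.comap (regularOpEquiv S).toLinearMap) m.unop m'.unop hm hmm'

theorem IsBooleanAlgebraSemiring.mul_comm {T : Type u} [Semiring T]
    (hT : IsBooleanAlgebraSemiring T) (a b : T) : a * b = b * a := by
  obtain ⟨_, -, hmul, -, -⟩ := hT
  rw [hmul, hmul, inf_comm]

theorem isSemisimpleRingDirectSumFiniteBooleanAlgebra_of_equiv_op {S' : Type u} [Semiring S']
    (h : IsSemisimpleRingDirectSumFiniteBooleanAlgebra S) (ψ : S' ≃+* Sᵐᵒᵖ) :
    IsSemisimpleRingDirectSumFiniteBooleanAlgebra S' := by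
  obtain ⟨R, T, _, _, _, _, hT, ⟨φ⟩⟩ := h
  let χ : (R × T)ᵐᵒᵖ ≃+* Rᵐᵒᵖ × T :=
    { toFun := fun x => (MulOpposite.op x.unop.1, x.unop.2)
      invFun := fun p => MulOpposite.op (p.1.unop, p.2)
      left_inv := fun _ => rfl
      right_inv := fun _ => rfl
      map_add' := fun _ _ => rfl
      map_mul' := fun x y => Prod.ext rfl (hT.mul_comm y.unop.2 x.unop.2) }
  exact ⟨Rᵐᵒᵖ, T, inferInstance, inferInstance, inferInstance, inferInstance, hT,
    ⟨(ψ.trans (RingEquiv.op φ)).trans χ⟩⟩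

theorem isSemisimpleRingDirectSumFiniteBooleanAlgebra_op_iff :
    IsSemisimpleRingDirectSumFiniteBooleanAlgebra Sᵐᵒᵖ ↔
      IsSemisimpleRingDirectSumFiniteBooleanAlgebra S :=
  ⟨fun h => isSemisimpleRingDirectSumFiniteBooleanAlgebra_of_equiv_op h (RingEquiv.opOp S),
    fun h => isSemisimpleRingDirectSumFiniteBooleanAlgebra_of_equiv_op h (RingEquiv.refl _)⟩

end Opposite

theorem theorem4p10 (S : Type u) [Semiring S] :
    (IsRightSubtractive S →
      (IsRightCPSemiring S ↔ IsSemisimpleRingDirectSumFiniteBooleanAlgebra S)) ∧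
    (IsLeftSubtractive S →
      (IsLeftCPSemiring S ↔ IsSemisimpleRingDirectSumFiniteBooleanAlgebra S)) := by
  refine ⟨fun h => ?_, isLeftCPSemiring_iff_of_isLeftSubtractive⟩
  rw [isRightCPSemiring_iff_op, isLeftCPSemiring_iff_of_isLeftSubtractive h.op,
    isSemisimpleRingDirectSumFiniteBooleanAlgebra_op_iff]
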